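/- Let $X$ be a countable regular $T_1$ topological space without isolated points. Identify subsets of $X$ with their characteristic functions, so that families of subsets of $X$ become subsets of the cube $2^X$ (product topology), and assume that the topology of $X$ is an analytic subset of $2^X$ (empty or a continuous image of $\mathbb{N}^{\mathbb{N}}$). Let $\mathfrak{D}(X)\subseteq 2^X$ be the family of all dense subsets of $X$. In the game $G_{fin}$ on $X$, in each round $n\in\mathbb{N}$ player I plays a dense set $D_n\subseteq X$ and then player II plays a finite set $a_n\subseteq D_n$; player II wins the run if $\bigcup_n a_n$ is dense in $X$, and otherwise player I wins. Then the game $G_{fin}$ on $X$ is determined, that is, one of the two players has a winning strategy. More precisely: (i) if $\mathfrak{D}(X)$ is a $G_\delta$ subset of $2^X$, then player II has a winning strategy; (ii) if $\mathfrak{D}(X)$ is not a $G_\delta$ subset of $2^X$, then player I has a winning strategy. Moreover, $X$ is $SS^+$ (that is, player II has a winning strategy in $G_{fin}$) if and only if $X$ has an $F_\sigma$ weak $\pi$-base, that is, an $F_\sigma$ subset $\mathcal{P}$ of $2^X$ such that every $V\in\mathcal{P}$ has non-empty interior and every non-empty open subset of $X$ contains some $V\in\mathcal{P}$. -/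

import Mathlib

open Set

/-- A family of subsets of `X`, seen as a subset of the Cantor cube `2^X = X → Bool` (with the product
topology, `Bool` being discrete) by identifying a subset of `X` with its characteristic function. -/
def inCube {X : Type*} (F : Set (Set X)) : Set (X → Bool) :=
  {f | {x | f x = true} ∈ F}

/-- The topology of `X` is analytic as a subset of the cube `2^X`. -/
def HasAnalyticTopology (X : Type*) [TopologicalSpace X] : Prop :=
  MeasureTheory.AnalyticSet (inCube {U : Set X | IsOpen U})

/-- The family `𝔇(X)` of all dense subsets of `X`. -/
def denseSets (X : Type*) [TopologicalSpace X] : Set (Set X) :=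
  {D | Dense D}

/-- A subset of a topological space is `F_σ` if it is a countable union of closed sets. -/
def IsFSigmaSet {Y : Type*} [TopologicalSpace Y] (A : Set Y) : Prop :=
  ∃ C : ℕ → Set Y, (∀ n, IsClosed (C n)) ∧ A = ⋃ n, C n

/-- A weak `π`-base: a family of sets (not necessarily open) with non-empty interior such that
every non-empty open set contains a member of the family. -/
def IsWeakPiBase {X : Type*} [TopologicalSpace X] (P : Set (Set X)) : Prop :=
  (∀ V ∈ P, (interior V).Nonempty) ∧
    ∀ W : Set X, IsOpen W → W.Nonempty → ∃ V ∈ P, V ⊆ W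

/-- The list `[s 0, …, s (n - 1)]` of the first `n` moves in a sequence of moves. -/
def firstMoves {α : Type*} (s : ℕ → α) (n : ℕ) : List α :=
  (List.range n).map s

/-!
The game `G_fin` on `X`: in round `n = 0, 1, 2, …` player I plays a dense set `D n`, then player II
plays a finite set `a n ⊆ D n` (possibly empty). Player II wins the run if `⋃ n, a n` is dense in `X`;
otherwise player I wins it. A strategy gives the next move of a player as a function of
the list of the moves that the opponent has made so far.
-/

/-- `τ` is a winning strategy for player I: I wins every run in which I plays
`D n = τ [a 0, …, a (n - 1)]` and the moves `a n` of II obey the rules. -/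
def IsWinningStrategyI {X : Type*} [TopologicalSpace X]
    (τ : List (Finset X) → denseSets X) : Prop :=
  ∀ a : ℕ → Finset X, (∀ n, (a n : Set X) ⊆ (τ (firstMoves a n) : Set X)) →
    ¬ Dense (⋃ n, (a n : Set X))

/-- `σ` is a winning strategy for player II: against all moves `D n` of I, the answers
`a n = σ [D 0, …, D n]` obey the rules and their union is dense. -/
def IsWinningStrategyII {X : Type*} [TopologicalSpace X]
    (σ : List (denseSets X) → Finset X) : Prop :=
  ∀ D : ℕ → denseSets X,
    (∀ n, (σ (firstMoves D (n + 1)) : Set X) ⊆ (D n : Set X)) ∧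
      Dense (⋃ n, (σ (firstMoves D (n + 1)) : Set X))

/-- Player I has a winning strategy in the game `G_fin` on `X`. -/
def PlayerIWinsGFin (X : Type*) [TopologicalSpace X] : Prop :=
  ∃ τ : List (Finset X) → denseSets X, IsWinningStrategyI τ

/-- Player II has a winning strategy in the game `G_fin` on `X`, i.e. `X` is `SS⁺`. -/
def PlayerIIWinsGFin (X : Type*) [TopologicalSpace X] : Prop :=
  ∃ σ : List (denseSets X) → Finset X, IsWinningStrategyII σ

/-- The game `G_fin` on `X` is determined: one of the players has a winning strategy. -/
def GFinDetermined (X : Type*) [TopologicalSpace X] : Prop :=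
  PlayerIWinsGFin X ∨ PlayerIIWinsGFin X

/-!
The argument replaces a determinacy theorem by a notion of smallness. Call a family of subsets of `X`
*small* if countably many closed, upward closed families, all of whose members have non-empty
interior, cover it. Small families form a `σ`-ideal, and two facts about them carry the proof.

* If the family of all non-empty open sets is small, then the family of all sets with non-empty
  interior is `F_σ`; passing to complements, `𝔇(X)` is `G_δ`. Conversely, when there is an `F_σ` weak
  `π`-base, it is a countable union of compact families, and in round `n` player II picks a finite
  subset of `D n` that meets all members of the `n`-th one (`playerIIWinsGFin_of_isWeakPiBase`).
* If a family `S` is not small, then there is a dense set `D` such that for each finite `a ⊆ D` the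
  members of `S` missing `a` still form a family that is not small (`exists_dense_not_isSmall`).
  Otherwise every dense set contains a finite `a` for which that family is small; the sets which meet
  all these countably many `a` meet every dense set, so they have non-empty interior, and they form a
  closed upward closed family. Together with the small families it covers `S`.

The topology being analytic, some continuous `φ` maps `ℕ → ℕ` onto the non-empty open sets. If these
are not a small family, player I plays the dense sets of the second fact and at the same time fixes,
one digit per round, a point `y : ℕ → ℕ`, keeping non-small the family of those `φ z` that miss all
moves of II, where `z` agrees with `y` in the digits fixed so far. By continuity, the open set `φ y`
misses all moves of II, so I wins (`playerIWinsGFin_of_not_isSmall`).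
-/

section

variable {X : Type*} [TopologicalSpace X]

/-! ### Small families -/

/-- A family of subsets of `X` (in the cube) is small if it is covered by countably many closed,
upward closed families consisting of sets with non-empty interior. -/
def IsSmall (S : Set (X → Bool)) : Prop :=
  ∃ 𝒞 : Set (Set (X → Bool)), 𝒞.Countable ∧
    (∀ C ∈ 𝒞, IsClosed C ∧ IsUpperSet C ∧ C ⊆ inCube {V : Set X | (interior V).Nonempty}) ∧
    S ⊆ ⋃₀ 𝒞

theorem IsSmall.mono {S T : Set (X → Bool)} (hT : IsSmall T) (h : S ⊆ T) : IsSmall S := by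
  obtain ⟨𝒞, h1, h2, h3⟩ := hT
  exact ⟨𝒞, h1, h2, h.trans h3⟩

theorem isSmall_empty : IsSmall (∅ : Set (X → Bool)) :=
  ⟨∅, countable_empty, by simp, by simp⟩

theorem IsSmall.iUnion {ι : Type*} [Countable ι] {S : ι → Set (X → Bool)}
    (h : ∀ i, IsSmall (S i)) : IsSmall (⋃ i, S i) := by
  choose 𝒞 h1 h2 h3 using h
  refine ⟨⋃ i, 𝒞 i, countable_iUnion h1, ?_, ?_⟩
  · intro C hC
    obtain ⟨i, hi⟩ := mem_iUnion.1 hC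
    exact h2 i C hi
  · refine iUnion_subset fun i => (h3 i).trans (sUnion_subset_sUnion (subset_iUnion 𝒞 i))

theorem IsSmall.union {S T : Set (X → Bool)} (hS : IsSmall S) (hT : IsSmall T) :
    IsSmall (S ∪ T) := by
  rw [union_eq_iUnion]
  exact IsSmall.iUnion (by rintro (_ | _) <;> assumption)

/-- A family that meets every dense set consists of sets with non-empty interior. -/
theorem interior_nonempty_of_meets_dense {V : Set X} (h : ∀ D : Set X, Dense D → (V ∩ D).Nonempty) :
    (interior V).Nonempty := by
  by_contra hV
  obtain ⟨x, hx, hx'⟩ := h Vᶜ (interior_eq_empty_iff_dense_compl.1 (not_nonempty_iff_eq_empty.1 hV))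
  exact hx' hx

/-- The step of player I: a non-small family has, for a suitable dense set `D`, a non-small
part missing `a`, whatever the finite answer `a ⊆ D`. -/
theorem exists_dense_not_isSmall [Countable X] {S : Set (X → Bool)} (hS : ¬ IsSmall S) :
    ∃ D : denseSets X, ∀ a : Finset X, (a : Set X) ⊆ D →
      ¬ IsSmall (S ∩ {f | ∀ x ∈ a, f x = false}) := by
  by_contra! hcon
  let A : Set (Finset X) := {a | IsSmall (S ∩ {f | ∀ x ∈ a, f x = false})}
  let C : Set (X → Bool) := ⋂ a ∈ A, ⋃ x ∈ a, {f | f x = true}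
  have hC : IsSmall C := by
    refine ⟨{C}, countable_singleton C, ?_, by simp⟩
    rintro _ rfl
    refine ⟨?_, ?_, ?_⟩
    · refine isClosed_biInter fun a _ => Set.Finite.isClosed_biUnion a.finite_toSet fun x _ => ?_
      exact isClosed_eq (continuous_apply x) continuous_const
    · intro f g hfg hf
      simp only [C, mem_iInter, mem_iUnion, mem_ofPred_eq, exists_prop] at hf ⊢
      intro a ha
      obtain ⟨x, hx, hfx⟩ := hf a ha
      exact ⟨x, hx, Bool.eq_true_of_true_le (hfx ▸ hfg x)⟩
    · intro f hf
      simp only [C, mem_iInter, mem_iUnion, mem_ofPred_eq, exists_prop] at hf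
      refine interior_nonempty_of_meets_dense fun D hD => ?_
      obtain ⟨a, haD, ha⟩ := hcon ⟨D, hD⟩
      obtain ⟨x, hx, hfx⟩ := hf a ha
      exact ⟨x, hfx, haD hx⟩
  refine hS ((hC.union (IsSmall.iUnion fun a : A => a.2)).mono fun f hf => ?_)
  by_cases h : f ∈ C
  · exact Or.inl h
  · simp only [C, mem_iInter, mem_iUnion, mem_ofPred_eq, exists_prop, not_forall, not_exists,
      not_and, Bool.not_eq_true] at h
    obtain ⟨a, ha, hfa⟩ := h
    exact Or.inr (mem_iUnion.2 ⟨⟨a, ha⟩, hf, hfa⟩)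

theorem isOpen_setOf_apply_eq_true {α : Type*} (x : α) : IsOpen {f : α → Bool | f x = true} :=
  (isClopen_discrete {true}).isOpen.preimage (continuous_apply (A := fun _ : α => Bool) x)

/-! ### A winning strategy for player I -/

theorem firstMoves_succ {α : Type*} (s : ℕ → α) (n : ℕ) :
    firstMoves s (n + 1) = firstMoves s n ++ [s n] := by
  simp [firstMoves, List.range_succ]

theorem length_firstMoves {α : Type*} (s : ℕ → α) (n : ℕ) : (firstMoves s n).length = n := by
  simp [firstMoves]

/-- If `φ` maps `ℕ → ℕ` continuously to non-empty open sets, and its range is not small, then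
player I wins. -/
theorem playerIWinsGFin_of_not_isSmall [Countable X] {φ : (ℕ → ℕ) → X → Bool}
    (hφ : Continuous φ) (hopen : ∀ y, IsOpen {x | φ y x = true})
    (hne : ∀ y, {x | φ y x = true}.Nonempty) (hS : ¬ IsSmall (range φ)) :
    PlayerIWinsGFin X := by
  have step : ∀ (n : ℕ) (T : Set (ℕ → ℕ)), ∃ (k : ℕ) (D : denseSets X), ¬ IsSmall (φ '' T) →
      ∀ a : Finset X, (a : Set X) ⊆ D →
        ¬ IsSmall (φ '' {y ∈ T | y n = k ∧ ∀ x ∈ a, φ y x = false}) := by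
    intro n T
    by_cases hT : IsSmall (φ '' T)
    · exact ⟨0, ⟨univ, dense_univ⟩, fun h => absurd hT h⟩
    have hk : ∃ k, ¬ IsSmall (φ '' {y ∈ T | y n = k}) := by
      by_contra! hk
      refine hT ((IsSmall.iUnion hk).mono ?_)
      rintro _ ⟨y, hy, rfl⟩
      exact mem_iUnion.2 ⟨y n, y, ⟨hy, rfl⟩, rfl⟩
    obtain ⟨k, hk⟩ := hk
    obtain ⟨D, hD⟩ := exists_dense_not_isSmall hk
    refine ⟨k, D, fun _ a ha hsm => hD a ha (hsm.mono ?_)⟩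
    rintro _ ⟨⟨y, ⟨hy, hyk⟩, rfl⟩, hya⟩
    exact ⟨y, ⟨hy, hyk, hya⟩, rfl⟩
  choose k D hD using step
  -- The round and the set of points of `ℕ → ℕ` still available, after the given moves of II.
  let next : ℕ × Set (ℕ → ℕ) → Finset X → ℕ × Set (ℕ → ℕ) := fun p a =>
    (p.1 + 1, {y ∈ p.2 | y p.1 = k p.1 p.2 ∧ ∀ x ∈ a, φ y x = false})
  let state : List (Finset X) → ℕ × Set (ℕ → ℕ) := fun l => l.foldl next (0, univ)
  refine ⟨fun l => D (state l).1 (state l).2, fun a ha hdense => ?_⟩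
  let p : ℕ → ℕ × Set (ℕ → ℕ) := fun n => state (firstMoves a n)
  have hp : ∀ n, p (n + 1) = next (p n) (a n) := fun n => by
    simp [p, state, firstMoves_succ, List.foldl_append]
  have hp1 : ∀ n, (p n).1 = n := fun n => by
    induction n with
    | zero => rfl
    | succ n ih => rw [hp]; simp [next, ih]
  have hp2 : ∀ n, (p (n + 1)).2 =
      {y ∈ (p n).2 | y n = k n (p n).2 ∧ ∀ x ∈ a n, φ y x = false} := fun n => by
    rw [hp]; simp [next, hp1]
  have hlarge : ∀ n, ¬ IsSmall (φ '' (p n).2) := fun n => by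
    induction n with
    | zero => simpa [p, state, firstMoves] using hS
    | succ n ih =>
      rw [hp2]
      have h := ha n
      change (a n : Set X) ⊆ D (p n).1 (p n).2 at h
      rw [hp1] at h
      exact hD n _ ih (a n) h
  have hmem : ∀ n, ∃ z, z ∈ (p n).2 := fun n => by
    by_contra h
    refine hlarge n ?_
    rw [show (p n).2 = ∅ from not_nonempty_iff_eq_empty.1 h, image_empty]
    exact isSmall_empty
  choose z hz using hmem
  have hanti : Antitone fun n => (p n).2 := antitone_nat_of_succ_le fun n => by
    rw [hp2]; exact sep_subset _ _
  have hz' : ∀ {i n}, i < n → z n i = k i (p i).2 ∧ ∀ x ∈ a i, φ (z n) x = false := by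
    intro i n hin
    have h : z n ∈ (p (i + 1)).2 := hanti hin (hz n)
    rw [hp2] at h
    exact h.2
  -- The point whose digits player I has fixed during the run.
  let y : ℕ → ℕ := fun i => k i (p i).2
  have hlim : Filter.Tendsto z Filter.atTop (nhds y) := by
    rw [tendsto_pi_nhds]
    intro i
    refine tendsto_const_nhds.congr' ?_
    filter_upwards [Filter.eventually_gt_atTop i] with n hn using (hz' hn).1.symm
  obtain ⟨x, hxy, hxa⟩ := hdense.inter_open_nonempty _ (hopen y) (hne y)
  obtain ⟨i, hi⟩ := mem_iUnion.1 hxa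
  have hx : Filter.Tendsto (fun n => φ (z n) x) Filter.atTop (nhds (φ y x)) :=
    (((continuous_apply x).comp hφ).tendsto y).comp hlim
  have hx' : Filter.Tendsto (fun n => φ (z n) x) Filter.atTop (nhds false) := by
    refine tendsto_const_nhds.congr' ?_
    filter_upwards [Filter.eventually_gt_atTop i] with n hn using ((hz' hn).2 x hi).symm
  have heq := tendsto_nhds_unique hx hx'
  rw [show φ y x = true from hxy] at heq
  exact Bool.noConfusion heq

/-! ### A winning strategy for player II -/

/-- Against a dense set, finitely many of its points suffice to meet all members of a closed family
of sets with non-empty interior: closed families in the cube are compact. -/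
theorem exists_finset_meets {C : Set (X → Bool)} (hC : IsClosed C)
    (hint : ∀ f ∈ C, (interior {x | f x = true}).Nonempty) (D : denseSets X) :
    ∃ a : Finset X, (a : Set X) ⊆ D ∧ ∀ f ∈ C, ∃ x ∈ a, f x = true := by
  classical
  obtain ⟨t, ht⟩ := hC.isCompact.elim_finite_subcover
    (fun x : (D : Set X) => {f : X → Bool | f x = true})
    (fun x => isOpen_setOf_apply_eq_true (x : X)) (by
      intro f hf
      obtain ⟨x, hx, hxD⟩ := Dense.inter_open_nonempty D.2 _ isOpen_interior (hint f hf)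
      have hfx : f x = true := interior_subset (s := {x | f x = true}) hx
      exact mem_iUnion.2 ⟨⟨x, hxD⟩, hfx⟩)
  refine ⟨t.image Subtype.val, ?_, fun f hf => ?_⟩
  · intro x hx
    obtain ⟨w, -, rfl⟩ := Finset.mem_image.1 (Finset.mem_coe.1 hx)
    exact w.2
  · obtain ⟨w, hw, hfw⟩ := mem_iUnion₂.1 (ht hf)
    exact ⟨w, Finset.mem_image_of_mem _ hw, hfw⟩

theorem playerIIWinsGFin_of_isWeakPiBase {P : Set (Set X)} (hP : IsFSigmaSet (inCube P))
    (hbase : IsWeakPiBase P) : PlayerIIWinsGFin X := by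
  classical
  obtain ⟨C, hC, hPC⟩ := hP
  have hint : ∀ n, ∀ f ∈ C n, (interior {x | f x = true}).Nonempty := fun n f hf =>
    hbase.1 _ (show f ∈ inCube P from hPC ▸ mem_iUnion.2 ⟨n, hf⟩)
  choose a ha1 ha2 using fun n => exists_finset_meets (hC n) (hint n)
  -- The answer depends only on the number of the round and on the last move of I.
  refine ⟨fun l => if h : l ≠ [] then a (l.length - 1) (l.getLast h) else ∅, fun D => ?_⟩
  have hmove : ∀ n, (if h : firstMoves D (n + 1) ≠ [] then
      a ((firstMoves D (n + 1)).length - 1) ((firstMoves D (n + 1)).getLast h) else ∅)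
      = a n (D n) := fun n => by
    simp [firstMoves_succ, length_firstMoves]
  simp only [hmove]
  refine ⟨fun n => ha1 n (D n), dense_iff_inter_open.2 fun W hW hne => ?_⟩
  obtain ⟨V, hV, hVW⟩ := hbase.2 W hW hne
  have hf : (fun x => decide (x ∈ V)) ∈ inCube P := by simpa [inCube] using hV
  rw [hPC] at hf
  obtain ⟨n, hn⟩ := mem_iUnion.1 hf
  obtain ⟨x, hx, hxV⟩ := ha2 n (D n) _ hn
  exact ⟨x, hVW (by simpa using hxV), mem_iUnion.2 ⟨n, hx⟩⟩

theorem isWeakPiBase_interior_nonempty : IsWeakPiBase {V : Set X | (interior V).Nonempty} :=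
  ⟨fun _ hV => hV, fun W hW hne => ⟨W, by simpa [hW.interior_eq] using hne, Subset.rfl⟩⟩

/-! ### The Borel class of the family of dense sets -/

/-- Complementation is a homeomorphism of the cube that exchanges the dense sets and the sets with
empty interior. -/
theorem isGδ_inCube_denseSets_iff : IsGδ (inCube (denseSets X)) ↔
    IsFSigmaSet (inCube {V : Set X | (interior V).Nonempty}) := by
  let c : (X → Bool) → X → Bool := fun f x => !f x
  have hc : Continuous c :=
    continuous_pi fun x => (continuous_of_discreteTopology (f := not)).comp (continuous_apply x)
  have hcc : ∀ f, c (c f) = f := fun f => by simp [c]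
  have hmem : ∀ f, f ∈ inCube (denseSets X) ↔
      c f ∉ inCube {V : Set X | (interior V).Nonempty} := fun f => by
    change Dense {x | f x = true} ↔ ¬ (interior {x | (!f x) = true}).Nonempty
    rw [not_nonempty_iff_eq_empty, interior_eq_empty_iff_dense_compl]
    simp [compl_ofPred]
  rw [isGδ_iff_eq_iInter_nat]
  constructor
  · rintro ⟨U, hU, hDU⟩
    refine ⟨fun n => c ⁻¹' (U n)ᶜ, fun n => (hU n).isClosed_compl.preimage hc, ?_⟩
    ext f
    have h := hmem (c f)
    rw [hcc, hDU] at h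
    rw [← not_iff_not, ← h]
    simp
  · rintro ⟨C, hC, hVC⟩
    refine ⟨fun n => c ⁻¹' (C n)ᶜ, fun n => (hC n).isOpen_compl.preimage hc, ?_⟩
    ext f
    rw [hmem, hVC]
    simp

/-- If the non-empty open sets form a small family, then the sets with non-empty interior are exactly
the members of the covering families, as these are upward closed. -/
theorem isFSigmaSet_of_isSmall (h : IsSmall (inCube {U : Set X | IsOpen U ∧ U.Nonempty})) :
    IsFSigmaSet (inCube {V : Set X | (interior V).Nonempty}) := by
  classical
  obtain ⟨𝒞, hcount, h𝒞, hcover⟩ := h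
  obtain ⟨C, hC⟩ := (hcount.insert ∅).exists_eq_range (insert_nonempty _ _)
  have hC' : ∀ n, C n = ∅ ∨ C n ∈ 𝒞 := fun n => mem_insert_iff.1 (hC ▸ mem_range_self n)
  refine ⟨C, fun n => ?_, Subset.antisymm (fun f hf => ?_) (iUnion_subset fun n => ?_)⟩
  · rcases hC' n with h | h
    · rw [h]; exact isClosed_empty
    · exact (h𝒞 _ h).1
  · have hg : (fun x => decide (x ∈ interior {x | f x = true})) ∈
        inCube {U : Set X | IsOpen U ∧ U.Nonempty} := by
      simpa [inCube] using hf
    obtain ⟨K, hK, hgK⟩ := hcover hg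
    obtain ⟨n, rfl⟩ : K ∈ range C := hC ▸ mem_insert_of_mem _ hK
    refine mem_iUnion.2 ⟨n, (h𝒞 _ hK).2.1 (fun x => ?_) hgK⟩
    by_cases hx : x ∈ interior {x | f x = true}
    · have hfx : f x = true := interior_subset (s := {x | f x = true}) hx
      simp [hfx]
    · simp [hx]
  · rcases hC' n with h | h
    · rw [h]; exact empty_subset _
    · exact (h𝒞 _ h).2.2

theorem analyticSet_nonempty_open [Countable X] (hX : HasAnalyticTopology X) :
    MeasureTheory.AnalyticSet (inCube {U : Set X | IsOpen U ∧ U.Nonempty}) := by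
  -- Instance search does not find `PolishSpace (X → Bool)` without this.
  have : PolishSpace Bool := inferInstance
  have hO : IsOpen {f : X → Bool | ∃ x, f x = true} := by
    rw [ofPred_exists]
    exact isOpen_iUnion fun x => isOpen_setOf_apply_eq_true x
  have h2 : MeasureTheory.AnalyticSet {f : X → Bool | ∃ x, f x = true} := by
    simpa using hO.analyticSet_image continuous_id
  have := MeasureTheory.AnalyticSet.iInter (ι := Bool)
    (s := fun b => cond b (inCube {U : Set X | IsOpen U}) {f : X → Bool | ∃ x, f x = true})
    (by rintro (_ | _) <;> assumption)
  convert this using 1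
  ext f
  simp [inCube, Set.Nonempty, and_comm]

/-! ### Determinacy -/

/-- The dichotomy behind determinacy. -/
theorem playerIWinsGFin_or_isGδ [Countable X] (hX : HasAnalyticTopology X) :
    PlayerIWinsGFin X ∨ IsGδ (inCube (denseSets X)) := by
  by_cases hS : IsSmall (inCube {U : Set X | IsOpen U ∧ U.Nonempty})
  · exact Or.inr (isGδ_inCube_denseSets_iff.2 (isFSigmaSet_of_isSmall hS))
  · left
    have han := analyticSet_nonempty_open hX
    rw [MeasureTheory.AnalyticSet] at han
    rcases han with h | ⟨φ, hφ, hr⟩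
    · exact absurd (h ▸ isSmall_empty) hS
    · have hmem : ∀ y, φ y ∈ inCube {U : Set X | IsOpen U ∧ U.Nonempty} :=
        fun y => hr ▸ mem_range_self y
      exact playerIWinsGFin_of_not_isSmall hφ (fun y => (hmem y).1) (fun y => (hmem y).2)
        (by rwa [hr])

/-- The two players cannot both win: play the two strategies against each other. -/
theorem PlayerIIWinsGFin.not_playerIWinsGFin (hII : PlayerIIWinsGFin X) : ¬ PlayerIWinsGFin X := by
  rintro ⟨τ, hτ⟩
  obtain ⟨σ, hσ⟩ := hII
  -- The moves of I and of II in the first `n` rounds.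
  let run : ℕ → List (denseSets X) × List (Finset X) := fun n =>
    Nat.rec ([], []) (fun _ p => (p.1 ++ [τ p.2], p.2 ++ [σ (p.1 ++ [τ p.2])])) n
  let D : ℕ → denseSets X := fun n => τ (run n).2
  let a : ℕ → Finset X := fun n => σ ((run n).1 ++ [D n])
  have hrun : ∀ n, run n = (firstMoves D n, firstMoves a n) := fun n => by
    induction n with
    | zero => rfl
    | succ n ih =>
      rw [firstMoves_succ, firstMoves_succ]
      change ((run n).1 ++ [D n], (run n).2 ++ [a n]) = _
      rw [ih]
  have ha : ∀ n, a n = σ (firstMoves D (n + 1)) := fun n => by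
    rw [firstMoves_succ]
    change σ ((run n).1 ++ [D n]) = _
    rw [hrun]
  obtain ⟨h1, h2⟩ := forall_and.1 hσ |>.imp (fun h => h D) (fun h => h D)
  simp only [← ha] at h1 h2
  refine hτ a (fun n => ?_) h2
  have h : (a n : Set X) ⊆ τ (run n).2 := h1 n
  rwa [hrun] at h

end

theorem theorem4p4 (X : Type*) [TopologicalSpace X] [RegularSpace X] [T1Space X] [Countable X]
    [PerfectSpace X] (hX : HasAnalyticTopology X) :
    GFinDetermined X ∧
      (IsGδ (inCube (denseSets X)) → PlayerIIWinsGFin X) ∧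
      (¬ IsGδ (inCube (denseSets X)) → PlayerIWinsGFin X) ∧
      (PlayerIIWinsGFin X ↔ ∃ P : Set (Set X), IsFSigmaSet (inCube P) ∧ IsWeakPiBase P) := by
  have hII : IsGδ (inCube (denseSets X)) → PlayerIIWinsGFin X := fun h =>
    playerIIWinsGFin_of_isWeakPiBase (isGδ_inCube_denseSets_iff.1 h) isWeakPiBase_interior_nonempty
  have hdich := playerIWinsGFin_or_isGδ hX
  refine ⟨hdich.imp_right hII, hII, hdich.resolve_right, fun h => ?_, ?_⟩
  · exact ⟨_, isGδ_inCube_denseSets_iff.1 (hdich.resolve_left h.not_playerIWinsGFin),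
      isWeakPiBase_interior_nonempty⟩
  · rintro ⟨P, hP, hbase⟩
    exact playerIIWinsGFin_of_isWeakPiBase hP hbase
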